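/- Theorem (Noisy small-angle detection). For $\varphi\in\mathbb{R}$ let $\mathcal{C}_\varphi[\rho]=e^{-i\frac{\varphi}{2}Z}\rho\,e^{i\frac{\varphi}{2}Z}$ be the single-qubit rotation channel about the $Z$-axis, and for $\theta\in\mathbb{R}$, $\gamma\ge 0$ let $\tilde{\mathcal{C}}_\theta=\mathbb{E}_{t\sim\mathcal{N}(0,\gamma)}[\mathcal{C}_{\theta+t}]$ be the corresponding channel with Gaussian angle noise of mean $0$ and variance $\gamma$. A $T$-query quantum algorithm on $N$ qubits has an ancilla register of arbitrary finite dimension. It starts in an arbitrary joint state of the $N$ qubits and the ancilla, queries the unknown $N$-qubit channel $T$ times (each query acts on the $N$ qubits and trivially on the ancilla), applies an arbitrary joint quantum channel (completely positive trace-preserving map) after each query, and finally performs an arbitrary two-outcome measurement whose outcome is its answer. In particular, adaptive strategies with intermediate measurements are allowed. The initial state, the operations and the measurement may depend on $N,T,\theta,\gamma$, but not on which channel is queried. There is a universal constant $c>0$ such that for all integers $N,T\ge 0$, all $\theta>0$ and all $\gamma\ge 0$ the following holds. If a $T$-query quantum algorithm distinguishes $\tilde{\mathcal{C}}_0^{\otimes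 N}$ from $\tilde{\mathcal{C}}_\theta^{\otimes N}$ with success probability $>2/3$, where the unknown channel is each of the two with probability $1/2$ (in particular, if its answer is correct with probability $>2/3$ for each of the two channels), then $$NT\;\ge\; c\,\max\!\left(\frac{\gamma}{\theta^2},\,\frac{1}{\theta}\right),$$ that is, $NT=\Omega\left(\max\left(\gamma/\theta^2,\,1/\theta\right)\right)$. -/

import Mathlib

open scoped Matrix NNReal ComplexOrder

noncomputable section

namespace NoisySensing

/-- Linear maps on the space of complex matrices with index set `ι` (super-operators). -/
abbrev SuperOp (ι : Type) : Type := Matrix ι ι ℂ →ₗ[ℂ] Matrix ι ι ℂ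

/-- `Φ ⊗ id`, where `id` is the identity super-operator on matrices with index set `κ`. -/
def tensorId {ι : Type} (κ : Type) (Φ : SuperOp ι) : SuperOp (ι × κ) where
  toFun ρ := Matrix.of fun p q => Φ (Matrix.of fun i j => ρ (i, p.2) (j, q.2)) p.1 q.1
  map_add' ρ σ := by
    ext p q
    exact congrFun (congrFun (Φ.map_add (Matrix.of fun i j => ρ (i, p.2) (j, q.2))
      (Matrix.of fun i j => σ (i, p.2) (j, q.2))) p.1) q.1
  map_smul' c ρ := by
    ext p q
    exact congrFun (congrFun (Φ.map_smul c (Matrix.of fun i j => ρ (i, p.2) (j, q.2))) p.1) q.1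

/-- Quantum channels: completely positive trace-preserving super-operators. -/
structure IsQuantumChannel {ι : Type} [Fintype ι] (Φ : SuperOp ι) : Prop where
  completelyPositive : ∀ (k : ℕ) (ρ : Matrix (ι × Fin k) (ι × Fin k) ℂ),
    ρ.PosSemidef → (tensorId (Fin k) Φ ρ).PosSemidef
  tracePreserving : ∀ ρ : Matrix ι ι ℂ, (Φ ρ).trace = ρ.trace

/-- The `N`-fold tensor power `Φ^{⊗ N}` of a single-qubit super-operator, acting on matrices
indexed by the computational basis of `N` qubits. It is the linear extension of
`|x'⟩⟨y'| ↦ ⨂ i, Φ |x' i⟩⟨y' i|`. -/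
def tensorPower (N : ℕ) (Φ : SuperOp (Fin 2)) : SuperOp (Fin N → Fin 2) where
  toFun ρ := Matrix.of fun x y => ∑ x' : Fin N → Fin 2, ∑ y' : Fin N → Fin 2,
    (∏ i, Φ (Matrix.single (x' i) (y' i) 1) (x i) (y i)) * ρ x' y'
  map_add' ρ σ := by
    ext x y
    simp [mul_add, Finset.sum_add_distrib]
  map_smul' c ρ := by
    ext x y
    simp [Finset.mul_sum, mul_left_comm]

/-- The Pauli matrix `Z`. -/
def pauliZ : Matrix (Fin 2) (Fin 2) ℂ := !![1, 0; 0, -1]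

/-- The rotation `exp(-i (φ/2) Z)` about the `Z`-axis by the angle `φ`. -/
def rotZ (φ : ℝ) : Matrix (Fin 2) (Fin 2) ℂ :=
  NormedSpace.exp ((-(Complex.I * ((φ / 2 : ℝ) : ℂ))) • pauliZ)

/-- The unitary channel `ρ ↦ exp(-i (φ/2) Z) ρ exp(i (φ/2) Z)`. -/
def rotChannel (φ : ℝ) : SuperOp (Fin 2) where
  toFun ρ := rotZ φ * ρ * rotZ (-φ)
  map_add' ρ σ := by rw [mul_add, add_mul]
  map_smul' c ρ := by simp

theorem rotZ_eq (φ : ℝ) : rotZ φ =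
    Matrix.diagonal ![Complex.exp (((-(φ / 2) : ℝ) : ℂ) * Complex.I),
      Complex.exp (((φ / 2 : ℝ) : ℂ) * Complex.I)] := by
  have h : (-(Complex.I * ((φ / 2 : ℝ) : ℂ))) • pauliZ =
      Matrix.diagonal ![((-(φ / 2) : ℝ) : ℂ) * Complex.I, ((φ / 2 : ℝ) : ℂ) * Complex.I] := by
    ext i j
    fin_cases i <;> fin_cases j <;> simp [pauliZ] <;> ring
  rw [rotZ, h, Matrix.exp_diagonal]
  congr 1
  ext i
  fin_cases i <;> simp [Complex.exp_eq_exp_ℂ]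

/-- The entries of the rotated matrix are integrable against the Gaussian noise, so that the
average in `noisyRotChannel` below is a genuine expectation. -/
theorem integrable_rotChannel (θ : ℝ) (γ : ℝ≥0) (ρ : Matrix (Fin 2) (Fin 2) ℂ) (i j : Fin 2) :
    MeasureTheory.Integrable (fun t : ℝ => rotChannel (θ + t) ρ i j)
      (ProbabilityTheory.gaussianReal 0 γ) := by
  have hn : ∀ (φ : ℝ) (k : Fin 2), ‖(![Complex.exp (((-(φ / 2) : ℝ) : ℂ) * Complex.I),
      Complex.exp (((φ / 2 : ℝ) : ℂ) * Complex.I)] : Fin 2 → ℂ) k‖ = 1 := by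
    intro φ k
    fin_cases k
    · exact Complex.norm_exp_ofReal_mul_I _
    · exact Complex.norm_exp_ofReal_mul_I _
  have he : ∀ t : ℝ, rotChannel (θ + t) ρ i j = rotZ (θ + t) i i * ρ i j * rotZ (-(θ + t)) j j := by
    intro t
    simp only [rotChannel, LinearMap.coe_mk, AddHom.coe_mk, rotZ_eq,
      Matrix.mul_diagonal, Matrix.diagonal_mul, Matrix.diagonal_apply_eq]
  have hc : Continuous fun t : ℝ => rotChannel (θ + t) ρ i j := by
    simp only [he, rotZ_eq, Matrix.diagonal_apply_eq]
    fin_cases i <;> fin_cases j <;> simp <;> fun_prop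
  refine MeasureTheory.Integrable.of_bound hc.aestronglyMeasurable ‖ρ i j‖ ?_
  refine Filter.Eventually.of_forall fun t => ?_
  rw [he, rotZ_eq, rotZ_eq, Matrix.diagonal_apply_eq, Matrix.diagonal_apply_eq, norm_mul, norm_mul,
    hn, hn, one_mul, mul_one]

/-- The noisy rotation channel: the expectation of the rotation channel by the angle `θ + t`,
where the noise `t` is Gaussian with mean zero and variance `γ`. -/
def noisyRotChannel (θ : ℝ) (γ : ℝ≥0) : SuperOp (Fin 2) where
  toFun ρ := Matrix.of fun i j =>
    ∫ t : ℝ, rotChannel (θ + t) ρ i j ∂(ProbabilityTheory.gaussianReal 0 γ)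
  map_add' ρ σ := by
    ext i j
    simp only [map_add, Matrix.add_apply, Matrix.of_apply]
    exact MeasureTheory.integral_add (integrable_rotChannel θ γ ρ i j)
      (integrable_rotChannel θ γ σ i j)
  map_smul' c ρ := by
    ext i j
    simp only [map_smul, Matrix.smul_apply, Matrix.of_apply, smul_eq_mul, RingHom.id_apply]
    exact MeasureTheory.integral_const_mul c _

/-- An adaptive quantum algorithm that makes `T` queries to an unknown channel on `N` qubits and
then outputs one bit. It has an ancilla register of arbitrary finite dimension, starts in an
arbitrary joint state of the `N` qubits and the ancilla, applies an arbitrary joint quantum channel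
after each query (this includes unitary gates, fresh ancillas, resets, and intermediate
measurements whose outcomes are stored and control later operations), and ends with an arbitrary
two-outcome measurement `{1 - effect, effect}`; the outcome of `effect` is the output `1`. -/
structure QuantumAlgorithm (N T : ℕ) where
  ancillaDim : ℕ
  init : Matrix ((Fin N → Fin 2) × Fin ancillaDim) ((Fin N → Fin 2) × Fin ancillaDim) ℂ
  init_posSemidef : init.PosSemidef
  init_trace : init.trace = 1
  op : Fin T → SuperOp ((Fin N → Fin 2) × Fin ancillaDim)
  op_isQuantumChannel : ∀ k, IsQuantumChannel (op k)
  effect : Matrix ((Fin N → Fin 2) × Fin ancillaDim) ((Fin N → Fin 2) × Fin ancillaDim) ℂ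
  effect_posSemidef : effect.PosSemidef
  one_sub_effect_posSemidef : (1 - effect).PosSemidef

namespace QuantumAlgorithm

variable {N T : ℕ}

/-- The state before the final measurement if the queried `N`-qubit channel is `C`: for
`k = 0, …, T - 1` in this order, `C ⊗ id` and then the `k`-th operation is applied. -/
def finalState (A : QuantumAlgorithm N T) (C : SuperOp (Fin N → Fin 2)) :
    Matrix ((Fin N → Fin 2) × Fin A.ancillaDim) ((Fin N → Fin 2) × Fin A.ancillaDim) ℂ :=
  (List.ofFn A.op).foldl (fun ρ E => E (tensorId (Fin A.ancillaDim) C ρ)) A.init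

/-- The probability that the algorithm outputs `1` if the queried channel is `C`. -/
def probOne (A : QuantumAlgorithm N T) (C : SuperOp (Fin N → Fin 2)) : ℝ :=
  (A.effect * A.finalState C).trace.re

/-- The probability that the algorithm outputs `0` if the queried channel is `C`. -/
def probZero (A : QuantumAlgorithm N T) (C : SuperOp (Fin N → Fin 2)) : ℝ :=
  ((1 - A.effect) * A.finalState C).trace.re

/-- The probability of a correct answer when the queried channel is `C₀` or `C₁`, each with
probability `1 / 2`. It exceeds `2 / 3` in particular if the answer is correct with probability
greater than `2 / 3` for each of the two channels. -/
def successProb (A : QuantumAlgorithm N T) (C₀ C₁ : SuperOp (Fin N → Fin 2)) : ℝ :=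
  (A.probZero C₀ + A.probOne C₁) / 2

end QuantumAlgorithm

end NoisySensing

end

open scoped Matrix NNReal ComplexOrder

noncomputable section

namespace NoisySensing

open Matrix

/-! Both channels are Schur multipliers, and they are diagonal blocks of one positive semidefinite
kernel, the Gram kernel of the states left in the environment. The angle `θ` is split as `2 * γ * s
+ η`: the noise density moves from `N(0, γ)` to `N(2γs, γ)`, which costs an overlap of square-root
densities, and `η` is a deterministic rotation. For label `a`, the amplitude at noise `t`, relative
to `N(0, γ)`, is `exp (a * (s * t - γ * s ^ 2))` times the phases; integrating a product of two
amplitudes gives `overlapExponent`.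

Run the algorithm on a matrix with an extra label qubit: the diagonal blocks are the two actual
runs, and the trace of the off-diagonal block starts at 1. A query moves this trace by at most `N *
(γ * s ^ 2 / 2 + |η| / 2)` (`exists_block_query`), and the intermediate channels preserve it. A
trace near 1 forces close output probabilities (`norm_trace_block_sq_le`). The choices `η = 0` and
`s = 0` give the two bounds. -/

/-! ### The channels as Schur multipliers -/

/-- The eigenvalues of the Pauli matrix `Z`. -/
def zSign (x : Fin 2) : ℝ := ![1, -1] x

theorem abs_zSign (x : Fin 2) : |zSign x| = 1 := by
  fin_cases x <;> simp [zSign]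

theorem rotZ_eq_diagonal (φ : ℝ) : rotZ φ =
    diagonal fun x => Complex.exp (-(φ * zSign x / 2) * Complex.I) := by
  rw [rotZ_eq]
  congr 1
  ext x
  fin_cases x <;> simp [zSign, neg_div]

theorem rotChannel_apply (φ : ℝ) (ρ : Matrix (Fin 2) (Fin 2) ℂ) (x y : Fin 2) :
    rotChannel φ ρ x y =
      Complex.exp (-(φ * (zSign x - zSign y) / 2) * Complex.I) * ρ x y := by
  simp only [rotChannel, LinearMap.coe_mk, AddHom.coe_mk, rotZ_eq_diagonal, mul_diagonal,
    diagonal_mul]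
  rw [mul_right_comm, ← Complex.exp_add]
  congr 2
  push_cast
  ring

theorem noisyRotChannel_apply (θ : ℝ) (γ : ℝ≥0) (ρ : Matrix (Fin 2) (Fin 2) ℂ) (x y : Fin 2) :
    noisyRotChannel θ γ ρ x y =
      Complex.exp (-(θ * (zSign x - zSign y) / 2) * Complex.I
        - γ * (zSign x - zSign y) ^ 2 / 8) * ρ x y := by
  have h := ProbabilityTheory.charFun_gaussianReal (μ := 0) (v := γ) (-((zSign x - zSign y) / 2))
  rw [MeasureTheory.charFun_apply_real] at h
  have e : ∀ t : ℝ, rotChannel (θ + t) ρ x y =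
      Complex.exp (-(θ * (zSign x - zSign y) / 2) * Complex.I) * ρ x y *
        Complex.exp ((-((zSign x - zSign y) / 2) : ℝ) * t * Complex.I) := by
    intro t
    rw [rotChannel_apply, mul_right_comm, ← Complex.exp_add]
    congr 2
    push_cast
    ring
  simp only [noisyRotChannel, LinearMap.coe_mk, AddHom.coe_mk, of_apply, e]
  rw [MeasureTheory.integral_const_mul, h, mul_right_comm, ← Complex.exp_add]
  congr 2
  push_cast
  ring

theorem tensorPower_apply_of_multiplier (N : ℕ) {Φ : SuperOp (Fin 2)} {q : Fin 2 → Fin 2 → ℂ}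
    (h : ∀ ρ x y, Φ ρ x y = q x y * ρ x y)
    (ρ : Matrix (Fin N → Fin 2) (Fin N → Fin 2) ℂ) (x y : Fin N → Fin 2) :
    tensorPower N Φ ρ x y = (∏ i, q (x i) (y i)) * ρ x y := by
  simp only [tensorPower, LinearMap.coe_mk, AddHom.coe_mk, of_apply, h]
  rw [Finset.sum_eq_single x, Finset.sum_eq_single y]
  · simp
  · intro y' _ hy
    obtain ⟨i, hi⟩ := Function.ne_iff.mp hy
    rw [Finset.prod_eq_zero (Finset.mem_univ i), zero_mul]
    simp [hi]
  · simp
  · intro x' _ hx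
    obtain ⟨i, hi⟩ := Function.ne_iff.mp hx
    refine Finset.sum_eq_zero fun y' _ => ?_
    rw [Finset.prod_eq_zero (Finset.mem_univ i), zero_mul]
    simp [hi]
  · simp

/-! ### Schur products and entrywise exponentials -/

theorem posSemidef_hadamard {ι : Type*} [Finite ι] {A B : Matrix ι ι ℂ} (hA : A.PosSemidef)
    (hB : B.PosSemidef) : (of fun i j => A i j * B i j).PosSemidef :=
  hA.hadamard hB

/-- The entrywise exponential of a positive semidefinite matrix is positive semidefinite. -/
theorem posSemidef_map_exp {ι : Type*} [Fintype ι] {A : Matrix ι ι ℂ} (hA : A.PosSemidef) :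
    (A.map Complex.exp).PosSemidef := by
  have hpow : ∀ n : ℕ, (A.map (· ^ n)).PosSemidef := by
    intro n
    induction n with
    | zero =>
      have e : A.map (· ^ 0) = vecMulVec (fun _ => 1) (star fun _ => 1) := by
        ext i j
        simp [vecMulVec_apply]
      rw [e]
      exact posSemidef_vecMulVec_self_star _
    | succ n ih =>
      simp only [pow_succ]
      exact posSemidef_hadamard ih hA
  refine PosSemidef.of_dotProduct_mulVec_nonneg ?_ fun v => ?_
  · ext i j
    simp only [conjTranspose_apply, map_apply, RCLike.star_def, ← Complex.exp_conj]
    rw [← RCLike.star_def, hA.isHermitian.apply]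
  · have hs : HasSum (fun n : ℕ => ((n.factorial : ℂ)⁻¹) * (star v ⬝ᵥ (A.map (· ^ n)) *ᵥ v))
        (star v ⬝ᵥ (A.map Complex.exp) *ᵥ v) := by
      simp only [dotProduct, mulVec, map_apply, Finset.mul_sum]
      refine hasSum_sum fun i _ => hasSum_sum fun j _ => ?_
      have h := (NormedSpace.expSeries_div_hasSum_exp (A i j)).mul_left (star v i * v j)
      rw [← Complex.exp_eq_exp_ℂ] at h
      have e : star v i * (Complex.exp (A i j) * v j) = star v i * v j * Complex.exp (A i j) := by
        ring
      rw [e]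
      have e' : (fun n : ℕ => ((n.factorial : ℂ)⁻¹) * (star v i * (A i j ^ n * v j))) =
          fun n => star v i * v j * (A i j ^ n / n.factorial) := by
        funext n
        simp only [div_eq_mul_inv]
        ring
      rw [e']
      exact h
    -- Each term is nonnegative by the Schur product theorem, so the quadratic form of the
    -- exponential is too.
    exact hs.nonneg fun n => mul_nonneg (by positivity) ((hpow n).dotProduct_mulVec_nonneg v)

/-! ### The joint kernel of the two channels -/

/-- The overlap kernel of one qubit: the exponent of the Gaussian overlap of the rotation
noises with respect to the drift `s`, together with a further rotation by the angle `η`. -/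
def overlapExponent (γ s η : ℝ) (p q : Fin 2 × Fin 2) : ℂ :=
  γ / 2 * ((p.2.val + q.2.val) * s - Complex.I * (zSign p.1 - zSign q.1) / 2) ^ 2
    - γ * s ^ 2 * (p.2.val + q.2.val)
    - Complex.I * η * (p.2.val * zSign p.1 - q.2.val * zSign q.1) / 2

/-- The overlap kernel of `N` qubits. -/
def overlapKernel (N : ℕ) (γ s η : ℝ) :
    Matrix ((Fin N → Fin 2) × Fin 2) ((Fin N → Fin 2) × Fin 2) ℂ :=
  of fun p q => Complex.exp (∑ i, overlapExponent γ s η (p.1 i, p.2) (q.1 i, q.2))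

/-- Expanding the square splits the exponent into `u p`, the conjugate of `u q`, and the Gram term
`γ * α p * star (α q)`. The kernel is thus a rank-one matrix times, entrywise, the exponential of a
Gram matrix. -/
theorem overlapKernel_posSemidef (N : ℕ) (γ : ℝ≥0) (s η : ℝ) :
    (overlapKernel N γ s η).PosSemidef := by
  let α : Fin 2 × Fin 2 → ℂ := fun p => p.2.val * s - Complex.I * zSign p.1 / 2
  let u : Fin 2 × Fin 2 → ℂ := fun p =>
    γ / 2 * α p ^ 2 - γ * s ^ 2 * p.2.val - Complex.I * η * (p.2.val * zSign p.1) / 2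
  let A : Matrix ((Fin N → Fin 2) × Fin 2) ((Fin N → Fin 2) × Fin 2) ℂ :=
    of fun p q => ∑ i, (γ : ℂ) * (α (p.1 i, p.2) * star (α (q.1 i, q.2)))
  have hA : A.PosSemidef := by
    have e : A = ∑ i : Fin N, (γ : ℂ) • vecMulVec (fun p => α (p.1 i, p.2))
        (star fun p => α (p.1 i, p.2)) := by
      ext p q
      simp [A, Matrix.sum_apply, vecMulVec_apply]
    rw [e]
    exact posSemidef_sum _ fun i _ => (posSemidef_vecMulVec_self_star _).smul (by simp)
  have h := posSemidef_hadamard (posSemidef_vecMulVec_self_star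
    fun p : (Fin N → Fin 2) × Fin 2 => Complex.exp (∑ i, u (p.1 i, p.2))) (posSemidef_map_exp hA)
  convert h using 1
  ext p q
  simp only [overlapKernel, of_apply, vecMulVec_apply, map_apply, Pi.star_apply,
    RCLike.star_def, ← Complex.exp_conj, map_sum, A, ← Complex.exp_add, ← Finset.sum_add_distrib]
  congr 1
  refine Finset.sum_congr rfl fun i _ => ?_
  simp only [overlapExponent, u, α, map_sub, map_mul, map_div₀, map_pow, Complex.conj_I,
    Complex.conj_ofReal, map_ofNat, map_natCast]
  ring

theorem tensorPower_noisyRotChannel_zero_apply (N : ℕ) (γ : ℝ≥0) (s η : ℝ)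
    (ρ : Matrix (Fin N → Fin 2) (Fin N → Fin 2) ℂ) (x y : Fin N → Fin 2) :
    tensorPower N (noisyRotChannel 0 γ) ρ x y =
      overlapKernel N γ s η (x, 0) (y, 0) * ρ x y := by
  rw [tensorPower_apply_of_multiplier N (noisyRotChannel_apply 0 γ), overlapKernel, of_apply,
    Complex.exp_sum]
  congr 2
  ext i
  congr 1
  simp only [overlapExponent, Fin.val_zero]
  push_cast
  ring_nf
  simp only [Complex.I_sq]
  ring

theorem tensorPower_noisyRotChannel_apply (N : ℕ) (γ : ℝ≥0) {θ s η : ℝ} (h : 2 * γ * s + η = θ)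
    (ρ : Matrix (Fin N → Fin 2) (Fin N → Fin 2) ℂ) (x y : Fin N → Fin 2) :
    tensorPower N (noisyRotChannel θ γ) ρ x y =
      overlapKernel N γ s η (x, 1) (y, 1) * ρ x y := by
  rw [tensorPower_apply_of_multiplier N (noisyRotChannel_apply θ γ), overlapKernel, of_apply,
    Complex.exp_sum, ← h]
  congr 2
  ext i
  congr 1
  simp only [overlapExponent, Fin.val_one]
  push_cast
  ring_nf
  simp only [Complex.I_sq]
  ring

theorem overlapKernel_self (N : ℕ) (γ s η : ℝ) (x : Fin N → Fin 2) (a : Fin 2) :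
    overlapKernel N γ s η (x, a) (x, a) = 1 := by
  rw [overlapKernel, of_apply, Finset.sum_eq_zero, Complex.exp_zero]
  intro i _
  fin_cases a
  · simp [overlapExponent]
  · simp [overlapExponent]
    ring

theorem norm_exp_neg_add_mul_I_sub_one_le {p : ℝ} (hp : 0 ≤ p) (q : ℝ) :
    ‖Complex.exp (-p + q * Complex.I) - 1‖ ≤ p + |q| := by
  have e : Complex.exp (-p + q * Complex.I) - 1 =
      (Real.exp (-p) : ℂ) * (Complex.exp (Complex.I * q) - 1) + ((Real.exp (-p) - 1 : ℝ) : ℂ) := by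
    rw [Complex.exp_add]
    push_cast
    rw [mul_comm Complex.I]
    ring
  rw [e]
  refine (norm_add_le _ _).trans ?_
  rw [norm_mul, Complex.norm_real, Complex.norm_real, Real.norm_eq_abs, Real.norm_eq_abs,
    abs_of_pos (Real.exp_pos _)]
  have h1 : Real.exp (-p) ≤ 1 := Real.exp_le_one_iff.mpr (by linarith)
  have h2 : 1 - p ≤ Real.exp (-p) := by linarith [Real.add_one_le_exp (-p)]
  have h3 := Real.norm_exp_I_mul_ofReal_sub_one_le (x := q)
  rw [Real.norm_eq_abs] at h3
  have h4 := mul_le_mul h1 h3 (norm_nonneg _) zero_le_one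
  rw [abs_of_nonpos (by linarith)]
  linarith

/-- Each qubit contributes the Gaussian affinity `exp (-γ * s ^ 2 / 2)` and a phase of angle `± η /
2`. -/
theorem norm_overlapKernel_sub_one_le (N : ℕ) (γ : ℝ≥0) (s η : ℝ) (x : Fin N → Fin 2) :
    ‖overlapKernel N γ s η (x, 0) (x, 1) - 1‖ ≤ N * (γ * s ^ 2 / 2 + |η| / 2) := by
  have e : overlapKernel N γ s η (x, 0) (x, 1) = Complex.exp
      (-(N * (γ * s ^ 2 / 2) : ℝ) + (∑ i, η * zSign (x i) / 2 : ℝ) * Complex.I) := by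
    rw [overlapKernel, of_apply]
    congr 1
    have hN : -((N * (γ * s ^ 2 / 2) : ℝ) : ℂ) = ∑ _i : Fin N, -((γ * s ^ 2 / 2 : ℝ) : ℂ) := by
      simp
    rw [hN]
    push_cast
    rw [Finset.sum_mul, ← Finset.sum_add_distrib]
    refine Finset.sum_congr rfl fun i _ => ?_
    simp only [overlapExponent, Fin.val_zero, Fin.val_one]
    push_cast
    ring
  rw [e, mul_add]
  refine (norm_exp_neg_add_mul_I_sub_one_le (by positivity) _).trans ?_
  gcongr
  refine (Finset.abs_sum_le_sum_abs _ _).trans ?_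
  simp [abs_div, abs_mul, abs_zSign]

/-! ### Block matrices and distinguishability -/

/-- The blocks of a matrix on a system with an additional qubit. -/
def block {κ : Type} (P : Matrix (κ × Fin 2) (κ × Fin 2) ℂ) (a b : Fin 2) : Matrix κ κ ℂ :=
  of fun i j => P (i, a) (j, b)

section PosSemidef

variable {κ : Type*}

theorem normSq_apply_le_of_posSemidef {P : Matrix κ κ ℂ} (hP : P.PosSemidef) (i j : κ) :
    ‖P i j‖ ^ 2 ≤ (P i i).re * (P j j).re := by
  have hd := (hP.submatrix ![i, j]).det_nonneg
  have hi := Complex.nonneg_iff.mp (hP.diag_nonneg (i := i))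
  have hj := Complex.nonneg_iff.mp (hP.diag_nonneg (i := j))
  have hij : P j i = star (P i j) := (hP.isHermitian.apply j i).symm
  rw [det_fin_two] at hd
  have h := (Complex.nonneg_iff.mp hd).1
  simp only [submatrix_apply, cons_val_zero, cons_val_one, hij, RCLike.star_def,
    Complex.mul_conj, Complex.sub_re, Complex.mul_re, Complex.ofReal_re, ← hi.2, ← hj.2,
    Complex.normSq_eq_norm_sq] at h
  linarith

theorem norm_apply_le_of_posSemidef {P : Matrix κ κ ℂ} (hP : P.PosSemidef) (i j : κ) :
    ‖P i j‖ ≤ ((P i i).re + (P j j).re) / 2 := by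
  have hi := (Complex.nonneg_iff.mp (hP.diag_nonneg (i := i))).1
  have hj := (Complex.nonneg_iff.mp (hP.diag_nonneg (i := j))).1
  have h := normSq_apply_le_of_posSemidef hP i j
  refine abs_le_of_sq_le_sq' ?_ (by linarith) |>.2
  nlinarith [sq_nonneg ((P i i).re - (P j j).re)]

end PosSemidef

section Block

variable {κ : Type} [Fintype κ]

theorem sum_norm_block_diag_le {P : Matrix (κ × Fin 2) (κ × Fin 2) ℂ} (hP : P.PosSemidef)
    (h0 : (block P 0 0).trace = 1) (h1 : (block P 1 1).trace = 1) :
    ∑ i, ‖block P 0 1 i i‖ ≤ 1 := by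
  calc ∑ i, ‖block P 0 1 i i‖
      ≤ ∑ i, ((block P 0 0 i i).re + (block P 1 1 i i).re) / 2 :=
        Finset.sum_le_sum fun i _ => norm_apply_le_of_posSemidef hP (i, 0) (i, 1)
    _ = ((block P 0 0).trace.re + (block P 1 1).trace.re) / 2 := by
        simp only [trace, diag, Complex.re_sum, ← Finset.sum_add_distrib, Finset.sum_div]
    _ = 1 := by rw [h0, h1]; norm_num

/-- Measuring an effect on all blocks gives a positive semidefinite matrix. -/
theorem posSemidef_trace_mul_block {P : Matrix (κ × Fin 2) (κ × Fin 2) ℂ} (hP : P.PosSemidef)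
    {E : Matrix κ κ ℂ} (hE : E.PosSemidef) :
    (of fun a b => (E * block P a b).trace : Matrix (Fin 2) (Fin 2) ℂ).PosSemidef := by
  -- Compressing by `B` sums the Hadamard product with `Eᵀ` over each block, which yields the trace.
  let B : Matrix (κ × Fin 2) (Fin 2) ℂ := of fun p a => if p.2 = a then 1 else 0
  have h := (posSemidef_hadamard (hE.transpose.submatrix Prod.fst) hP).conjTranspose_mul_mul_same B
  convert h using 1
  ext a b
  simp [B, trace, diag, mul_apply, block, Fintype.sum_prod_type, apply_ite]

/-- The probabilities of an effect in the two diagonal blocks of a positive semidefinite matrix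
differ little if the trace of its off-diagonal block is close to one. -/
theorem norm_trace_block_sq_le {P : Matrix (κ × Fin 2) (κ × Fin 2) ℂ} [DecidableEq κ]
    (hP : P.PosSemidef) (h0 : (block P 0 0).trace = 1) (h1 : (block P 1 1).trace = 1)
    {E : Matrix κ κ ℂ} (hE : E.PosSemidef) (hE' : (1 - E).PosSemidef) :
    ‖(block P 0 1).trace‖ ^ 2 ≤
      1 - ((E * block P 1 1).trace.re - (E * block P 0 0).trace.re) ^ 2 := by
  have hs : ∀ a b, ((1 - E) * block P a b).trace = (block P a b).trace - (E * block P a b).trace :=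
    fun a b => by rw [sub_mul, one_mul, trace_sub]
  have hQ := posSemidef_trace_mul_block hP hE
  have hR := posSemidef_trace_mul_block hP hE'
  have q0 := (Complex.nonneg_iff.mp (hQ.diag_nonneg (i := 0))).1
  have q1 := (Complex.nonneg_iff.mp (hQ.diag_nonneg (i := 1))).1
  have r0 := (Complex.nonneg_iff.mp (hR.diag_nonneg (i := 0))).1
  have r1 := (Complex.nonneg_iff.mp (hR.diag_nonneg (i := 1))).1
  have hq := normSq_apply_le_of_posSemidef hQ 0 1
  have hr := normSq_apply_le_of_posSemidef hR 0 1
  simp only [of_apply] at q0 q1 r0 r1 hq hr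
  have ht : ‖(block P 0 1).trace‖ ≤
      ‖(E * block P 0 1).trace‖ + ‖((1 - E) * block P 0 1).trace‖ := by
    refine le_trans (le_of_eq ?_) (norm_add_le _ _)
    rw [hs]
    congr 1
    ring
  rw [hs 0 0, h0, Complex.sub_re, Complex.one_re] at r0 hr
  rw [hs 1 1, h1, Complex.sub_re, Complex.one_re] at r1 hr
  generalize (E * block P 0 0).trace.re = a at *
  generalize (E * block P 1 1).trace.re = b at *
  generalize ‖(E * block P 0 1).trace‖ = x at *
  generalize hy : ‖((1 - E) * block P 0 1).trace‖ = y at *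
  -- Here `x ^ 2 ≤ a * b` and `y ^ 2 ≤ (1 - a) * (1 - b)`; the product is regrouped before AM-GM so
  -- that the final sum is exactly `1 - (b - a) ^ 2`.
  have hxy : 2 * (x * y) ≤ a * (1 - a) + b * (1 - b) := by
    refine (abs_le_of_sq_le_sq' ?_ (by positivity)).2
    have := mul_le_mul hq hr (by positivity) (by positivity)
    nlinarith [sq_nonneg (a * (1 - a) - b * (1 - b))]
  have := pow_le_pow_left₀ (norm_nonneg _) ht 2
  nlinarith

end Block

/-! ### Evolution of the joint matrix -/

section Query

variable {X κ : Type} [Fintype X] [Fintype κ]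

/-- A query to one of two Schur multipliers which have a joint positive semidefinite kernel. -/
theorem exists_block_query {K : Matrix (X × Fin 2) (X × Fin 2) ℂ} (hK : K.PosSemidef)
    (hK1 : ∀ p, K p p = 1) {δ : ℝ} (hδ : ∀ x, ‖K (x, 0) (x, 1) - 1‖ ≤ δ)
    {C : Fin 2 → SuperOp X} (hC : ∀ a ρ x y, C a ρ x y = K (x, a) (y, a) * ρ x y)
    {P : Matrix ((X × κ) × Fin 2) ((X × κ) × Fin 2) ℂ} (hP : P.PosSemidef)
    (hP1 : ∀ a, (block P a a).trace = 1) :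
    ∃ P' : Matrix ((X × κ) × Fin 2) ((X × κ) × Fin 2) ℂ, P'.PosSemidef ∧
      (∀ a, block P' a a = tensorId κ (C a) (block P a a)) ∧
      (∀ a, (block P' a a).trace = 1) ∧
      ‖(block P' 0 1).trace - (block P 0 1).trace‖ ≤ δ := by
  refine ⟨_, posSemidef_hadamard (hK.submatrix fun p : (X × κ) × Fin 2 => (p.1.1, p.2)) hP,
    fun a => ?_, fun a => ?_, ?_⟩
  · ext p q
    simp [block, tensorId, hC]
  · rw [← hP1 a]
    simp [block, trace, hK1]
  · rw [← trace_sub, trace]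
    calc _ ≤ ∑ p, δ * ‖block P 0 1 p p‖ := by
          refine norm_sum_le_of_le _ fun p _ => ?_
          have e : ∀ k z : ℂ, k * z - z = (k - 1) * z := fun k z => by ring
          simp only [block, diag_apply, Matrix.sub_apply, of_apply, submatrix_apply, e, norm_mul]
          exact mul_le_mul_of_nonneg_right (hδ _) (norm_nonneg _)
      _ ≤ δ := by
          rw [← Finset.mul_sum]
          -- A point of `X` is needed for `0 ≤ δ`; an empty `X` contradicts trace one.
          rcases isEmpty_or_nonempty X with hX | ⟨⟨x⟩⟩
          · have := hP1 0
            simp [trace] at this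
          · exact mul_le_of_le_one_right ((norm_nonneg _).trans (hδ x))
              (sum_norm_block_diag_le hP (hP1 0) (hP1 1))

/-- Complete positivity with a two-dimensional ancilla keeps the joint matrix positive, and trace
preservation applies to the off-diagonal block as well, so only queries change its trace. -/
theorem exists_block_foldl [DecidableEq X] [DecidableEq κ]
    {K : Matrix (X × Fin 2) (X × Fin 2) ℂ} (hK : K.PosSemidef)
    (hK1 : ∀ p, K p p = 1) {δ : ℝ} (hδ : ∀ x, ‖K (x, 0) (x, 1) - 1‖ ≤ δ)
    {C : Fin 2 → SuperOp X} (hC : ∀ a ρ x y, C a ρ x y = K (x, a) (y, a) * ρ x y)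
    (L : List (SuperOp (X × κ))) (hL : ∀ E ∈ L, IsQuantumChannel E)
    {P : Matrix ((X × κ) × Fin 2) ((X × κ) × Fin 2) ℂ} (hP : P.PosSemidef)
    (hP1 : ∀ a, (block P a a).trace = 1) :
    ∃ P' : Matrix ((X × κ) × Fin 2) ((X × κ) × Fin 2) ℂ, P'.PosSemidef ∧
      (∀ a, block P' a a = L.foldl (fun ρ E => E (tensorId κ (C a) ρ)) (block P a a)) ∧
      (∀ a, (block P' a a).trace = 1) ∧
      ‖(block P' 0 1).trace - (block P 0 1).trace‖ ≤ L.length * δ := by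
  induction L generalizing P with
  | nil => exact ⟨P, hP, fun a => rfl, hP1, by simp⟩
  | cons E L ih =>
    obtain ⟨Q, hQ, hQb, hQ1, hQt⟩ := exists_block_query hK hK1 hδ hC hP hP1
    have hE := hL E List.mem_cons_self
    have hb : ∀ a b, block (tensorId (Fin 2) E Q) a b = E (block Q a b) := fun a b => rfl
    obtain ⟨R, hR, hRb, hR1, hRt⟩ := ih (fun F hF => hL F (List.mem_cons_of_mem _ hF))
      (hE.completelyPositive 2 Q hQ) fun a => by rw [hb, hE.tracePreserving, hQ1]
    refine ⟨R, hR, fun a => ?_, hR1, ?_⟩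
    · rw [hRb, hb, hQb, List.foldl_cons]
    · rw [hb, hE.tracePreserving] at hRt
      have := norm_add_le ((block R 0 1).trace - (block Q 0 1).trace)
        ((block Q 0 1).trace - (block P 0 1).trace)
      rw [sub_add_sub_cancel] at this
      rw [List.length_cons]
      push_cast
      linarith

end Query

/-! ### The query lower bound -/

/-- An algorithm which succeeds with probability greater than `2 / 3` needs many queries. -/
theorem QuantumAlgorithm.le_mul_of_successProb {N T : ℕ} (γ : ℝ≥0) {θ s η : ℝ}
    (h : 2 * γ * s + η = θ) (A : QuantumAlgorithm N T)
    (hA : 2 / 3 < A.successProb (tensorPower N (noisyRotChannel 0 γ))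
      (tensorPower N (noisyRotChannel θ γ))) :
    1 / 20 ≤ T * (N * (γ * s ^ 2 / 2 + |η| / 2)) := by
  let C : Fin 2 → SuperOp (Fin N → Fin 2) := ![tensorPower N (noisyRotChannel 0 γ),
    tensorPower N (noisyRotChannel θ γ)]
  have hC : ∀ a ρ x y, C a ρ x y = overlapKernel N γ s η (x, a) (y, a) * ρ x y := by
    intro a ρ x y
    fin_cases a
    · exact tensorPower_noisyRotChannel_zero_apply N γ s η ρ x y
    · exact tensorPower_noisyRotChannel_apply N γ h ρ x y
  obtain ⟨P, hP, hPb, hP1, hPt⟩ := exists_block_foldl (overlapKernel_posSemidef N γ s η)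
    (fun p => overlapKernel_self N γ s η p.1 p.2) (norm_overlapKernel_sub_one_le N γ s η) hC
    (List.ofFn A.op) (List.forall_mem_ofFn_iff.mpr A.op_isQuantumChannel)
    -- The initial state tensored with the all-ones matrix: every block is `A.init`.
    (A.init_posSemidef.submatrix Prod.fst) fun a => A.init_trace
  have hb : ∀ a b, block (A.init.submatrix Prod.fst Prod.fst) a b = A.init := fun a b => rfl
  simp only [hb] at hPb hPt
  have hF : ∀ a, block P a a = A.finalState (C a) := hPb
  have hsq := norm_trace_block_sq_le hP (hP1 0) (hP1 1) A.effect_posSemidef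
    A.one_sub_effect_posSemidef
  have h0 := hP1 0
  rw [hF] at h0
  rw [hF, hF] at hsq
  have hs : 1 / 3 < (A.effect * A.finalState (C 1)).trace.re
      - (A.effect * A.finalState (C 0)).trace.re := by
    have : A.successProb (C 0) (C 1) = (1 - (A.effect * A.finalState (C 0)).trace.re
        + (A.effect * A.finalState (C 1)).trace.re) / 2 := by
      rw [successProb, probZero, probOne, sub_mul, one_mul, trace_sub, h0, Complex.sub_re,
        Complex.one_re]
    have hA' : 2 / 3 < A.successProb (C 0) (C 1) := hA
    linarith
  rw [A.init_trace, List.length_ofFn] at hPt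
  have ht := norm_sub_norm_le (1 : ℂ) (block P 0 1).trace
  rw [norm_one, norm_sub_rev] at ht
  by_contra! hc
  -- Contradiction, since `(19 / 20) ^ 2 > 8 / 9 = 1 - (1 / 3) ^ 2`.
  have : 19 / 20 < ‖(block P 0 1).trace‖ := by linarith
  nlinarith

end NoisySensing

end

theorem mainTheorem2 :
    ∃ c : ℝ, 0 < c ∧
      ∀ (N T : ℕ) (θ : ℝ) (γ : ℝ≥0), 0 < θ →
        ∀ A : NoisySensing.QuantumAlgorithm N T,
          2 / 3 < A.successProb
            (NoisySensing.tensorPower N (NoisySensing.noisyRotChannel 0 γ))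
            (NoisySensing.tensorPower N (NoisySensing.noisyRotChannel θ γ)) →
          c * max ((γ : ℝ) / θ ^ 2) (1 / θ) ≤ (N : ℝ) * (T : ℝ) := by
  -- The choice `s = 0` gives `N * T * θ / 2 ≥ 1 / 20`, hence `1 / 10`; the choice `η = 0` would
  -- allow `2 / 5`.
  refine ⟨1 / 10, by norm_num, fun N T θ γ hθ A hA => ?_⟩
  rw [mul_max_of_nonneg _ _ (by norm_num), max_le_iff]
  constructor
  · rcases eq_or_ne γ 0 with rfl | hγ
    · simp only [NNReal.coe_zero, zero_div, mul_zero]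
      positivity
    · have hγ' : (0 : ℝ) < γ := by positivity
      have h := A.le_mul_of_successProb γ (s := θ / (2 * γ)) (η := 0) (by field_simp; ring) hA
      have e : (T : ℝ) * (N * (γ * (θ / (2 * γ)) ^ 2 / 2 + |(0 : ℝ)| / 2)) =
          N * T * (θ ^ 2 / (8 * γ)) := by
        rw [abs_zero]
        field_simp
        ring
      rw [e, ← mul_div_assoc, le_div_iff₀ (by positivity)] at h
      rw [← mul_div_assoc, div_le_iff₀ (by positivity)]
      linarith
  · have h := A.le_mul_of_successProb γ (s := 0) (η := θ) (by ring) hA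
    rw [abs_of_pos hθ] at h
    rw [← mul_div_assoc, div_le_iff₀ hθ]
    linarith
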